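/- Let $P$ be a Markov kernel on a measurable space $(\mathsf X,\mathcal X)$. Assume there are $C\in\mathcal X$, $\epsilon\in(0,1]$ and a probability measure $\nu$ such that $P(x,\cdot)\ge\epsilon\nu$ for all $x\in C$. For $x\in C$ let $Q(x,\cdot)=(1-\epsilon)^{-1}(P(x,\cdot)-\epsilon\nu)$ if $\epsilon<1$ and $Q(x,\cdot)=\nu$ if $\epsilon=1$. Let $\check P$ be any Markov kernel on $\mathsf X\times\mathsf X$ such that the marginals of $\check P(x,x';\cdot)$ are $P(x,\cdot)$ and $P(x',\cdot)$ if $(x,x')\notin C\times C$, and $Q(x,\cdot)$ and $Q(x',\cdot)$ if $(x,x')\in C\times C$. Let $\check{\mathbb E}_{x,x'}$ be the expectation for the Markov chain $(X_k,X_k')_{k\ge0}$ with kernel $\check P$ started at $(x,x')$, and let $\sigma=\inf\{k\ge0:(X_k,X'_k)\in C\times C\}$ and $\tau=\inf\{k\ge1:(X_k,X'_k)\in C\times C\}$, with $\inf\emptyset=\infty$. Let $r:\mathbb N\to(0,\infty)$ be a subgeometric sequence: $r$ is non-decreasing, and $(\log r(n)/n)_{n\ge1}$ is non-increasing with limit $0$.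 Put $R(n)=\sum_{k=0}^{n-1}r(k)$. Let $W:\mathsf X\times\mathsf X\to[1,\infty)$ be measurable and $\delta>0$, and define \[ R^*=\sup_{(y,y')\in C\times C}\check{\mathbb E}_{y,y'}\Big[\sum_{k=1}^{\tau}r(k)\Big],\qquad W^*=\sup_{(y,y')\in C\times C}\check{\mathbb E}_{y,y'}\Big[\sum_{k=1}^{\tau}W(X_k,X'_k)\Big], \] \[ M=(1+\delta)\sup_{n\ge1}\Big\{R^*r(n-1)-\frac{\epsilon(1-\epsilon)\delta}{1+\delta}R(n)\Big\}_+ . \] Let $0\le\rho\le1$ and let $\alpha,\beta$ be non-negative functions on $(0,\infty)$ such that $\alpha(u)\beta(v)\le\rho u+(1-\rho)v$ for all $u,v>0$. Then for every non-negative function $f$ on $\mathsf X$ with $f(y)+f(y')\le\beta(W(y,y'))$ for all $y,y'\in\mathsf X$, and for all $x,x'\in\mathsf X$, \[ \sum_{n=1}^\infty\alpha(r(n))\,\|P^n(x,\cdot)-P^n(x',\cdot)\|_f\le \rho(1+\delta)\,\check{\mathbb E}_{x,x'}\Big[\sum_{k=0}^{\sigma}r(k)\Big] +(1-\rho)\,\check{\mathbb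 E}_{x,x'}\Big[\sum_{k=0}^{\sigma}W(X_k,X'_k)\Big] +\frac{1-\epsilon}{\epsilon}\{\rho M+(1-\rho)W^*\}, \] where $\|\mu\|_f=\sup_{|g|\le f}|\mu(g)|$ (supremum over measurable $g$ for which $\mu(g)$ is defined); both sides take values in $[0,\infty]$, with $0\cdot\infty=0$. -/

import Mathlib

open MeasureTheory ProbabilityTheory Filter Topology
open scoped ENNReal

namespace Subgeom

noncomputable section

/-- Subgeometric rate sequences: positive non-decreasing sequences `r` such that
`log r(n) / n` decreases to `0` (over `n ≥ 1`). -/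
structure IsSubgeometric (r : ℕ → ℝ) : Prop where
  pos : ∀ n, 0 < r n
  mono : Monotone r
  anti : ∀ m n : ℕ, 1 ≤ m → m ≤ n → Real.log (r n) / n ≤ Real.log (r m) / m
  tendsto : Tendsto (fun n : ℕ => Real.log (r n) / n) atTop (𝓝 0)

/-- `C` is a (one-step) small set for `P` with constant `ε` and minorizing probability `ν`. -/
def IsSmall {X : Type*} [MeasurableSpace X] (P : Kernel X X) (C : Set X) (ε : ℝ)
    (ν : Measure X) : Prop :=
  ∀ x ∈ C, ∀ A : Set X, MeasurableSet A → ENNReal.ofReal ε * ν A ≤ P x A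

open scoped Classical in
/-- The residual kernel `Q(x, A)`, for `x ∈ C`: it is `(1 - ε)⁻¹ (P(x, A) - ε ν(A))` if `ε < 1`
and `ν(A)` if `ε = 1`. The subtraction is not truncated, by the minorization. -/
def residual {X : Type*} [MeasurableSpace X] (P : Kernel X X) (ε : ℝ) (ν : Measure X)
    (x : X) (A : Set X) : ℝ≥0∞ :=
  if ε < 1 then (ENNReal.ofReal (1 - ε))⁻¹ * (P x A - ENNReal.ofReal ε * ν A) else ν A

open scoped Classical in
/-- `K` is a transition kernel on `X × X` whose two marginals are `P(x, ·)` and `P(x', ·)`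
off `C × C`, and `Q(x, ·)` and `Q(x', ·)` on `C × C`, with `Q` the residual kernel. -/
structure IsCouplingKernel {X : Type*} [MeasurableSpace X] (K : Kernel (X × X) (X × X))
    (P : Kernel X X) (C : Set X) (ε : ℝ) (ν : Measure X) : Prop where
  fst : ∀ (x x' : X) (A : Set X), MeasurableSet A →
    K (x, x') (A ×ˢ Set.univ) = if (x, x') ∈ C ×ˢ C then residual P ε ν x A else P x A
  snd : ∀ (x x' : X) (A : Set X), MeasurableSet A →
    K (x, x') (Set.univ ×ˢ A) = if (x, x') ∈ C ×ˢ C then residual P ε ν x' A else P x' A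

/-- The law, on the path space `ℕ → E`, of the homogeneous Markov chain with transition kernel
`K` started at `z` (Ionescu-Tulcea). -/
def chainLaw {E : Type*} [MeasurableSpace E] (K : Kernel E E) [IsMarkovKernel K] (z : E) :
    Measure (ℕ → E) :=
  Kernel.traj (X := fun _ : ℕ => E)
    (fun n : ℕ => K.comap
      (fun h : ({i // i ∈ Finset.Iic n} → E) => h ⟨n, Finset.mem_Iic.2 le_rfl⟩)
      (measurable_pi_apply _))
    0 (fun _ => z)

/-- The hitting time `σ = inf {k ≥ 0 : Z_k ∈ D}` of a path `Z` (`⊤` if there is none). -/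
def hitTime {E : Type*} (D : Set E) (ω : ℕ → E) : ℕ∞ :=
  hittingAfter (fun (n : ℕ) (ω : ℕ → E) => ω n) D 0 ω

/-- The return time `τ = inf {k ≥ 1 : Z_k ∈ D}` of a path `Z` (`⊤` if there is none). -/
def returnTime {E : Type*} (D : Set E) (ω : ℕ → E) : ℕ∞ :=
  hittingAfter (fun (n : ℕ) (ω : ℕ → E) => ω n) D 1 ω

open scoped Classical in
/-- `E_z [∑_{k=0}^σ g(k, Z_k)]`, in `[0, ∞]`. -/
def hitSum {E : Type*} [MeasurableSpace E] (K : Kernel E E) [IsMarkovKernel K] (D : Set E)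
    (g : ℕ → E → ℝ≥0∞) (z : E) : ℝ≥0∞ :=
  ∫⁻ ω, ∑' k : ℕ, (if (k : ℕ∞) ≤ hitTime D ω then g k (ω k) else 0) ∂(chainLaw K z)

open scoped Classical in
/-- `E_z [∑_{k=1}^τ g(k, Z_k)]`, in `[0, ∞]`. -/
def returnSum {E : Type*} [MeasurableSpace E] (K : Kernel E E) [IsMarkovKernel K] (D : Set E)
    (g : ℕ → E → ℝ≥0∞) (z : E) : ℝ≥0∞ :=
  ∫⁻ ω, ∑' k : ℕ, (if 1 ≤ k ∧ (k : ℕ∞) ≤ returnTime D ω then g k (ω k) else 0) ∂(chainLaw K z)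

/-- `sup_{z ∈ D} E_z [∑_{k=1}^τ g(k, Z_k)]`. -/
def returnSup {E : Type*} [MeasurableSpace E] (K : Kernel E E) [IsMarkovKernel K] (D : Set E)
    (g : ℕ → E → ℝ≥0∞) : ℝ≥0∞ :=
  ⨆ z ∈ D, returnSum K D g z

/-- The constant `(1 + δ) sup_{n ≥ 1} {R* r(n-1) - ε (1 - ε) δ R(n) / (1 + δ)}₊`, where
`R(n) = ∑_{k < n} r(k)`; the index `n` below stands for `n - 1`, and the truncated subtraction
of `ℝ≥0∞` is the positive part. -/
def constM (Rstar : ℝ≥0∞) (r : ℕ → ℝ) (ε δ : ℝ) : ℝ≥0∞ :=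
  ENNReal.ofReal (1 + δ) * ⨆ n : ℕ,
    (Rstar * ENNReal.ofReal (r n) -
      ENNReal.ofReal (ε * (1 - ε) * δ * (∑ k ∈ Finset.range (n + 1), r k) / (1 + δ)))

/-- The `f`-norm `sup_{|g| ≤ f} |μ₁(g) - μ₂(g)|` of `μ₁ - μ₂`, with values in `[0, ∞]`; the
supremum is over the measurable `g` for which both integrals make sense. -/
def fNorm {X : Type*} [MeasurableSpace X] (f : X → ℝ) (μ₁ μ₂ : Measure X) : ℝ≥0∞ :=
  ⨆ (g : X → ℝ) (_ : Measurable g) (_ : ∀ y, |g y| ≤ f y) (_ : Integrable g μ₁)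
    (_ : Integrable g μ₂), ENNReal.ofReal |∫ y, g y ∂μ₁ - ∫ y, g y ∂μ₂|

end

end Subgeom

open Subgeom

namespace Subgeom

noncomputable section

/-! Run the coupled chain and, at each visit to `D = C × C`, let it survive only with probability `1
- ε`; let `T` be the resulting operator `stepOp (damp D (1 - ε)) K`. On `D` the two laws `P(x, ·)`
and `P(x', ·)` share the piece `ε ν`, which cancels in their difference, so the difference of the
`P^n`-integrals of `g` is at most `T^n` applied to `|g(y)| + |g(y')|`
(`ofReal_abs_integral_pow_sub_le_of_integrable`). The inequality on `α`, `β` then reduces everything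
to the two potentials `∑ r(n) T^n 1` and `∑ T^n W`.

Hitting sums satisfy the one-step equation for `T` exactly off `D`; on `D` the defect is `1 - ε`
times a return sum. Comparison (`sum_damp_iterate_le`) bounds each potential by a hitting sum plus
return sums weighted by the visits `d_n = T^n 1_D`. With `u_n = T^n 1`, mass balance reads `ε d_n =
u_n - u_{n+1}`, hence `∑ d_n ≤ 1/ε`, which settles `W`.

For `r`, submultiplicativity bounds the return sum started at time `n ≥ 1` by `R* r(n)`, and `M` is
designed so that this is at most `M/(1+δ)` plus a small multiple of `ε R(n+1)`. Summation by parts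
turns `∑ ε d_n R(n+1)` back into at most the potential of `r` itself; it is absorbed on the left at
the price of the factor `1 + δ` (`sum_damp_rate_le`). -/

/-- The weighted transition operator `h ↦ w · K h` on non-negative functions. -/
def stepOp {E : Type*} [MeasurableSpace E] (w : E → ℝ≥0∞) (K : Kernel E E) (h : E → ℝ≥0∞)
    (z : E) : ℝ≥0∞ :=
  w z * ∫⁻ y, h y ∂(K z)

/-! ### Algebra of the weighted transition operator. -/

section StepOp

variable {E : Type*} [MeasurableSpace E] {w : E → ℝ≥0∞} {K : Kernel E E}

lemma measurable_stepOp (hw : Measurable w) {h : E → ℝ≥0∞} (hh : Measurable h) :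
    Measurable (stepOp w K h) :=
  hw.mul hh.lintegral_kernel

lemma measurable_stepOp_iterate (hw : Measurable w) {h : E → ℝ≥0∞} (hh : Measurable h) (n : ℕ) :
    Measurable ((stepOp w K)^[n] h) := by
  induction n with
  | zero => exact hh
  | succ n ih => rw [Function.iterate_succ_apply']; exact measurable_stepOp hw ih

lemma stepOp_mono {h₁ h₂ : E → ℝ≥0∞} (h : h₁ ≤ h₂) : stepOp w K h₁ ≤ stepOp w K h₂ :=
  fun _ => mul_le_mul_right (lintegral_mono h) _

lemma stepOp_iterate_mono {h₁ h₂ : E → ℝ≥0∞} (h : h₁ ≤ h₂) (n : ℕ) :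
    (stepOp w K)^[n] h₁ ≤ (stepOp w K)^[n] h₂ := by
  induction n with
  | zero => exact h
  | succ n ih => simp only [Function.iterate_succ_apply']; exact stepOp_mono ih

lemma stepOp_add {h₁ : E → ℝ≥0∞} (hh : Measurable h₁) (h₂ : E → ℝ≥0∞) :
    stepOp w K (h₁ + h₂) = stepOp w K h₁ + stepOp w K h₂ := by
  ext z
  simp [stepOp, lintegral_add_left hh, mul_add]

lemma stepOp_iterate_add (hw : Measurable w) {h₁ h₂ : E → ℝ≥0∞} (hh₁ : Measurable h₁)
    (n : ℕ) :
    (stepOp w K)^[n] (h₁ + h₂) = (stepOp w K)^[n] h₁ + (stepOp w K)^[n] h₂ := by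
  induction n with
  | zero => rfl
  | succ n ih =>
    simp only [Function.iterate_succ_apply', ih]
    exact stepOp_add (measurable_stepOp_iterate hw hh₁ n) _

lemma stepOp_const_mul (c : ℝ≥0∞) {h : E → ℝ≥0∞} (hh : Measurable h) :
    stepOp w K (fun y => c * h y) = fun z => c * stepOp w K h z := by
  ext z
  simp only [stepOp, lintegral_const_mul c hh]
  ring

lemma stepOp_iterate_const_mul (hw : Measurable w) (c : ℝ≥0∞) {h : E → ℝ≥0∞} (hh : Measurable h)
    (n : ℕ) :
    (stepOp w K)^[n] (fun y => c * h y) = fun z => c * (stepOp w K)^[n] h z := by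
  induction n with
  | zero => rfl
  | succ n ih =>
    simp only [Function.iterate_succ_apply', ih]
    exact stepOp_const_mul c (measurable_stepOp_iterate hw hh n)

lemma stepOp_const [IsMarkovKernel K] (c : ℝ≥0∞) (z : E) :
    stepOp w K (fun _ => c) z = w z * c := by
  simp [stepOp]

lemma stepOp_sum {g : ℕ → E → ℝ≥0∞} (hg : ∀ k, Measurable (g k)) (s : Finset ℕ) (z : E) :
    stepOp w K (fun y => ∑ k ∈ s, g k y) z = ∑ k ∈ s, stepOp w K (g k) z := by
  simp only [stepOp]
  rw [lintegral_finsetSum _ fun k _ => hg k, Finset.mul_sum]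

end StepOp

/-! ### Path expectations as iterates of the weighted operator. -/

section ChainLaw

variable {E : Type*} [MeasurableSpace E] (K : Kernel E E) [IsMarkovKernel K] (z : E)

instance : IsProbabilityMeasure (chainLaw K z) := by
  unfold chainLaw; infer_instance

lemma lintegral_chainLaw_zero {h : E → ℝ≥0∞} (hh : Measurable h) :
    ∫⁻ ω, h (ω 0) ∂(chainLaw K z) = h z := by
  unfold chainLaw
  rw [Kernel.lintegral_traj _ (by fun_prop)]
  simp [Function.updateFinset]

/-- The Markov property at time `n`. -/
lemma lintegral_chainLaw_succ (n : ℕ) {F : (Finset.Iic n → E) → ℝ≥0∞} (hF : Measurable F)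
    {h : E → ℝ≥0∞} (hh : Measurable h) :
    ∫⁻ ω, F (fun i => ω i) * h (ω (n + 1)) ∂(chainLaw K z) =
      ∫⁻ ω, F (fun i => ω i) * (∫⁻ y, h y ∂(K (ω n))) ∂(chainLaw K z) := by
  unfold chainLaw
  set κ : (n : ℕ) → Kernel (Finset.Iic n → E) E := fun n : ℕ => K.comap
      (fun h : ({i // i ∈ Finset.Iic n} → E) => h ⟨n, Finset.mem_Iic.2 le_rfl⟩)
      (measurable_pi_apply _)
  have h1 := Kernel.partialTraj_compProd_eq_map_traj (X := fun _ => E) (κ := κ)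
    (Nat.zero_le n) (x₀ := fun _ => z)
  have h2 := Kernel.traj_map_frestrictLe_apply (X := fun _ => E) (κ := κ) 0 n (fun _ => z)
  have e1 : ∫⁻ ω, F (fun i => ω i) * h (ω (n + 1)) ∂(Kernel.traj (X := fun _ => E) κ 0 fun _ => z)
      = ∫⁻ p, F p.1 * h p.2 ∂((Kernel.traj (X := fun _ => E) κ 0 fun _ => z).map
        fun x => (Preorder.frestrictLe n x, x (n + 1))) := by
    rw [lintegral_map (by fun_prop) (by fun_prop)]
    rfl
  have e2 : ∫⁻ ω, F (fun i => ω i) * (∫⁻ y, h y ∂(K (ω n)))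
        ∂(Kernel.traj (X := fun _ => E) κ 0 fun _ => z)
      = ∫⁻ p, F p * (∫⁻ y, h y ∂(κ n p)) ∂((Kernel.traj (X := fun _ => E) κ 0 fun _ => z).map
        (Preorder.frestrictLe n)) := by
    rw [lintegral_map (f := fun p => F p * ∫⁻ y, h y ∂(κ n p)) (hF.mul hh.lintegral_kernel)
      (by fun_prop)]
    rfl
  rw [e1, e2, ← h1, h2, Measure.lintegral_compProd (by fun_prop)]
  refine lintegral_congr fun p => ?_
  exact lintegral_const_mul (F p) hh

lemma lintegral_chainLaw_prod_succ {w : ℕ → E → ℝ≥0∞} (hw : ∀ i, Measurable (w i))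
    {h : E → ℝ≥0∞} (hh : Measurable h) (k : ℕ) :
    ∫⁻ ω, (∏ i ∈ Finset.range (k + 1), w i (ω i)) * h (ω (k + 1)) ∂(chainLaw K z) =
      ∫⁻ ω, (∏ i ∈ Finset.range k, w i (ω i)) * stepOp (w k) K h (ω k) ∂(chainLaw K z) := by
  have := lintegral_chainLaw_succ K z k
    (F := fun p => ∏ i : Finset.range (k + 1),
      w i (p ⟨i, Finset.mem_Iic.2 (Nat.lt_succ_iff.1 (Finset.mem_range.1 i.2))⟩))
    (Finset.measurable_fun_prod _ fun i _ => (hw i).comp (measurable_pi_apply _)) hh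
  have e : ∀ ω : ℕ → E, ∏ i : Finset.range (k + 1), w i (ω i) =
      ∏ i ∈ Finset.range (k + 1), w i (ω i) :=
    fun ω => Finset.prod_coe_sort (Finset.range (k + 1)) (fun i => w i (ω i))
  simp only [e] at this
  rw [this]
  refine lintegral_congr fun ω => ?_
  rw [Finset.prod_range_succ, stepOp, mul_assoc]

lemma lintegral_chainLaw_prod {w : E → ℝ≥0∞} (hw : Measurable w) (k : ℕ)
    {h : E → ℝ≥0∞} (hh : Measurable h) :
    ∫⁻ ω, (∏ i ∈ Finset.range k, w (ω i)) * h (ω k) ∂(chainLaw K z) =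
      (stepOp w K)^[k] h z := by
  induction k generalizing h with
  | zero => simpa using lintegral_chainLaw_zero K z hh
  | succ k ih =>
    rw [lintegral_chainLaw_prod_succ K z (w := fun _ => w) (fun _ => hw) hh,
      ih (measurable_stepOp hw hh), Function.iterate_succ_apply]

/-- The weight at time `0` is replaced by `1` because a return time ignores the initial position;
the first step is then an unweighted integral against `K z`. -/
lemma lintegral_chainLaw_prod_shift {w : E → ℝ≥0∞} (hw : Measurable w) (k : ℕ)
    {h : E → ℝ≥0∞} (hh : Measurable h) :
    ∫⁻ ω, (∏ i ∈ Finset.range (k + 1), if i = 0 then 1 else w (ω i)) * h (ω (k + 1))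
        ∂(chainLaw K z) =
      ∫⁻ y, (stepOp w K)^[k] h y ∂(K z) := by
  have key := fun (k : ℕ) (h : E → ℝ≥0∞) (hh : Measurable h) =>
    lintegral_chainLaw_prod_succ K z (w := fun i y => if i = 0 then 1 else w y)
      (fun i => by by_cases hi : i = 0 <;> simp [hi, hw]) hh k
  induction k generalizing h with
  | zero =>
    rw [key 0 h hh]
    simpa [stepOp] using lintegral_chainLaw_zero K z hh.lintegral_kernel
  | succ k ih =>
    rw [key (k + 1) h hh]
    simp only [Nat.add_eq_zero_iff, one_ne_zero, and_false, if_false]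
    rw [Function.iterate_succ_apply]
    exact ih (measurable_stepOp hw hh)

end ChainLaw

/-! ### Hitting and return sums; first-step analysis. -/

section Hitting

variable {E : Type*}

lemma le_hittingAfter_iff (D : Set E) (m k : ℕ) (ω : ℕ → E) :
    (k : WithTop ℕ) ≤ hittingAfter (fun (n : ℕ) (ω : ℕ → E) => ω n) D m ω ↔
      ∀ i < k, m ≤ i → ω i ∉ D := by
  rw [← not_lt, show (hittingAfter (fun (n : ℕ) (ω : ℕ → E) => ω n) D m ω < k) ↔ _ from
    hittingAfter_lt_iff]
  push Not
  constructor
  · intro h i hi hm; exact h i ⟨hm, hi⟩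
  · intro h i hi; exact h i hi.2 hi.1

-- Writing the event as a product of indicators of `Dᶜ` turns stopping at `D` into a multiplicative
-- weight, to which the iterate formula applies.
open scoped Classical in
lemma indicator_le_hitTime (D : Set E) (k : ℕ) (ω : ℕ → E) (c : ℝ≥0∞) :
    (if (k : ℕ∞) ≤ hitTime D ω then c else 0) =
      (∏ i ∈ Finset.range k, Dᶜ.indicator 1 (ω i)) * c := by
  have : (k : ℕ∞) ≤ hitTime D ω ↔ ∀ i < k, ω i ∉ D := by
    exact (le_hittingAfter_iff D 0 k ω).trans (by simp)
  simp only [this]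
  split_ifs with h
  · rw [Finset.prod_eq_one, one_mul]
    intro i hi
    simp [h i (Finset.mem_range.1 hi)]
  · push Not at h
    obtain ⟨i, hi, hD⟩ := h
    rw [Finset.prod_eq_zero (Finset.mem_range.2 hi), zero_mul]
    simp [hD]

open scoped Classical in
lemma indicator_le_returnTime (D : Set E) (k : ℕ) (ω : ℕ → E) (c : ℝ≥0∞) :
    (if 1 ≤ k + 1 ∧ ((k + 1 : ℕ) : ℕ∞) ≤ returnTime D ω then c else 0) =
      (∏ i ∈ Finset.range (k + 1), if i = 0 then 1 else Dᶜ.indicator 1 (ω i)) * c := by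
  have : ((k + 1 : ℕ) : ℕ∞) ≤ returnTime D ω ↔ ∀ i < k + 1, 1 ≤ i → ω i ∉ D :=
    le_hittingAfter_iff D 1 (k + 1) ω
  simp only [this, Nat.le_add_left, true_and]
  split_ifs with h
  · rw [Finset.prod_eq_one, one_mul]
    intro i hi
    split_ifs with h0
    · rfl
    · simp [h i (Finset.mem_range.1 hi) (Nat.pos_of_ne_zero h0)]
  · push Not at h
    obtain ⟨i, hi, h1, hD⟩ := h
    rw [Finset.prod_eq_zero (Finset.mem_range.2 hi), zero_mul]
    simp [hD, Nat.pos_iff_ne_zero.1 h1]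

variable [MeasurableSpace E] (K : Kernel E E) [IsMarkovKernel K] {D : Set E}

lemma hitSum_eq_tsum (hD : MeasurableSet D) {g : ℕ → E → ℝ≥0∞} (hg : ∀ k, Measurable (g k))
    (z : E) :
    hitSum K D g z = ∑' k, (stepOp (Dᶜ.indicator 1) K)^[k] (g k) z := by
  have hw : Measurable (Dᶜ.indicator (1 : E → ℝ≥0∞)) := measurable_one.indicator hD.compl
  unfold hitSum
  simp only [indicator_le_hitTime]
  rw [lintegral_tsum fun k => by
    exact ((Finset.measurable_fun_prod _ fun i _ => hw.comp (measurable_pi_apply i)).mul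
      ((hg k).comp (measurable_pi_apply k))).aemeasurable]
  exact tsum_congr fun k => lintegral_chainLaw_prod K z hw k (hg k)

lemma returnSum_eq_tsum (hD : MeasurableSet D) {g : ℕ → E → ℝ≥0∞} (hg : ∀ k, Measurable (g k))
    (z : E) :
    returnSum K D g z = ∑' k, ∫⁻ y, (stepOp (Dᶜ.indicator 1) K)^[k] (g (k + 1)) y ∂(K z) := by
  have hw : Measurable (Dᶜ.indicator (1 : E → ℝ≥0∞)) := measurable_one.indicator hD.compl
  unfold returnSum
  have : ∀ ω : ℕ → E, (∑' k : ℕ, (if 1 ≤ k ∧ (k : ℕ∞) ≤ returnTime D ω then g k (ω k) else 0)) =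
      ∑' k : ℕ, (∏ i ∈ Finset.range (k + 1), if i = 0 then 1 else Dᶜ.indicator 1 (ω i)) *
        g (k + 1) (ω (k + 1)) := by
    intro ω
    rw [tsum_eq_zero_add' ENNReal.summable]
    simp only [indicator_le_returnTime]
    simp
  simp only [this]
  rw [lintegral_tsum fun k => by
    refine ((Finset.measurable_fun_prod _ fun i _ => ?_).mul
      ((hg (k + 1)).comp (measurable_pi_apply (k + 1)))).aemeasurable
    by_cases hi : i = 0
    · simp [hi]
    · simp only [hi, if_false]
      exact hw.comp (measurable_pi_apply i)]
  exact tsum_congr fun k => lintegral_chainLaw_prod_shift K z hw k (hg (k + 1))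

lemma measurable_hitSum (hD : MeasurableSet D) {g : ℕ → E → ℝ≥0∞} (hg : ∀ k, Measurable (g k)) :
    Measurable (hitSum K D g) := by
  have hw : Measurable (Dᶜ.indicator (1 : E → ℝ≥0∞)) := measurable_one.indicator hD.compl
  rw [funext (hitSum_eq_tsum K hD hg)]
  exact Measurable.tsum fun k => measurable_stepOp_iterate hw (hg k) k

lemma returnSum_eq_lintegral (hD : MeasurableSet D) {g : ℕ → E → ℝ≥0∞}
    (hg : ∀ k, Measurable (g k)) (z : E) :
    returnSum K D g z = ∫⁻ y, hitSum K D (fun k => g (k + 1)) y ∂(K z) := by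
  have hw : Measurable (Dᶜ.indicator (1 : E → ℝ≥0∞)) := measurable_one.indicator hD.compl
  rw [returnSum_eq_tsum K hD hg, ← lintegral_tsum fun k =>
    (measurable_stepOp_iterate hw (hg (k + 1)) k).aemeasurable]
  exact lintegral_congr fun y => (hitSum_eq_tsum K hD (fun k => hg (k + 1)) y).symm

/-- First-step analysis of the hitting sums. -/
lemma hitSum_eq_add (hD : MeasurableSet D) {g : ℕ → E → ℝ≥0∞} (hg : ∀ k, Measurable (g k))
    (z : E) :
    hitSum K D g z =
      g 0 z + Dᶜ.indicator 1 z * ∫⁻ y, hitSum K D (fun k => g (k + 1)) y ∂(K z) := by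
  have hw : Measurable (Dᶜ.indicator (1 : E → ℝ≥0∞)) := measurable_one.indicator hD.compl
  rw [← returnSum_eq_lintegral K hD hg, returnSum_eq_tsum K hD hg, hitSum_eq_tsum K hD hg,
    tsum_eq_zero_add' ENNReal.summable, ← ENNReal.tsum_mul_left]
  simp only [Function.iterate_succ_apply']
  rfl

end Hitting

/-! ### Comparison with supersolutions. -/

section Comparison

variable {E : Type*} [MeasurableSpace E] {w : E → ℝ≥0∞} {K : Kernel E E}

/-- The comparison principle: a time-dependent supersolution, up to the source term `χ`, dominates
the partial sums of the potential. -/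
lemma sum_iterate_le_of_supersolution (hw : Measurable w) {φ ψ χ : ℕ → E → ℝ≥0∞}
    (hφ : ∀ n, Measurable (φ n)) (hψ : ∀ n, Measurable (ψ n)) (hχ : ∀ n, Measurable (χ n))
    (h : ∀ t z, φ t z + stepOp w K (ψ (t + 1)) z ≤ ψ t z + χ t z) (m t : ℕ) (z : E) :
    ∑ n ∈ Finset.range m, (stepOp w K)^[n] (φ (t + n)) z ≤
      ψ t z + ∑ n ∈ Finset.range m, (stepOp w K)^[n] (χ (t + n)) z := by
  induction m generalizing t z with
  | zero => simp
  | succ m ih =>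
    -- Peeling off the outermost step makes the remaining sum start at time `t + 1` from the next
    -- state, hence the induction over all `t` and `z`.
    have split : ∀ {g : ℕ → E → ℝ≥0∞}, (∀ n, Measurable (g n)) →
        ∑ n ∈ Finset.range (m + 1), (stepOp w K)^[n] (g (t + n)) z =
          stepOp w K (fun y => ∑ n ∈ Finset.range m, (stepOp w K)^[n] (g (t + 1 + n)) y) z +
            g t z := by
      intro g hg
      rw [Finset.sum_range_succ', stepOp_sum fun n => measurable_stepOp_iterate hw (hg _) n]
      simp only [Function.iterate_succ_apply', add_comm, add_left_comm, Function.iterate_zero, id,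
        Nat.add_zero]
    rw [split hφ, split hχ]
    calc _ ≤ stepOp w K (ψ (t + 1) +
            fun y => ∑ n ∈ Finset.range m, (stepOp w K)^[n] (χ (t + 1 + n)) y) z + φ t z := by
          gcongr
          exact stepOp_mono (fun y => ih (t + 1) y) z
      _ = (φ t z + stepOp w K (ψ (t + 1)) z) +
            stepOp w K
              (fun y => ∑ n ∈ Finset.range m, (stepOp w K)^[n] (χ (t + 1 + n)) y) z := by
          rw [stepOp_add (hψ _), Pi.add_apply]; ring
      _ ≤ (ψ t z + χ t z) + stepOp w K
              (fun y => ∑ n ∈ Finset.range m, (stepOp w K)^[n] (χ (t + 1 + n)) y) z := by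
          exact add_le_add (h t z) le_rfl
      _ = _ := by ring

end Comparison

/-! ### The chain killed with probability `e = 1 - a` at visits to `D`. -/

open scoped Classical in
/-- The weight equal to `a` on `D` and to `1` off `D`. -/
def damp {E : Type*} (D : Set E) (a : ℝ≥0∞) (z : E) : ℝ≥0∞ := if z ∈ D then a else 1

section Damp

variable {E : Type*} [MeasurableSpace E] {K : Kernel E E} [IsMarkovKernel K] {D : Set E}
  {a e : ℝ≥0∞}

lemma measurable_damp (hD : MeasurableSet D) : Measurable (damp D a) :=
  Measurable.ite hD measurable_const measurable_const

lemma measurable_returnSum (hD : MeasurableSet D) {g : ℕ → E → ℝ≥0∞}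
    (hg : ∀ k, Measurable (g k)) : Measurable (returnSum K D g) := by
  rw [funext (returnSum_eq_lintegral K hD hg)]
  exact (measurable_hitSum K hD fun k => hg (k + 1)).lintegral_kernel

/-- Regeneration decomposition of the damped potential over the successive visits to `D`. -/
lemma sum_damp_iterate_le (hD : MeasurableSet D) {g : ℕ → E → ℝ≥0∞}
    (hg : ∀ k, Measurable (g k)) (m : ℕ) (z : E) :
    ∑ n ∈ Finset.range m, (stepOp (damp D a) K)^[n] (g n) z ≤
      hitSum K D g z + ∑ n ∈ Finset.range m, (stepOp (damp D a) K)^[n]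
        (D.indicator fun y => a * returnSum K D (fun k => g (n + k)) y) z := by
  have := sum_iterate_le_of_supersolution (K := K) (measurable_damp (a := a) hD)
    (φ := g) (ψ := fun t => hitSum K D fun k => g (t + k))
    (χ := fun t => D.indicator fun y => a * returnSum K D (fun k => g (t + k)) y)
    hg (fun t => measurable_hitSum K hD fun k => hg _)
    (fun t => ((measurable_returnSum hD fun k => hg _).const_mul a).indicator hD) ?_ m 0 z
  · simpa only [zero_add] using this
  -- Off `D` this is the first-step equation. On `D` the hitting sum is only its time-`0` term, and
  -- the weighted step produces exactly the source `a` times the return sum.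
  · intro t y
    rw [hitSum_eq_add K hD (fun k => hg (t + k)), returnSum_eq_lintegral K hD (fun k => hg (t + k)) |>
      funext]
    simp only [stepOp, damp, Set.indicator, Set.mem_compl_iff, add_assoc, add_comm 1, add_zero]
    by_cases hy : y ∈ D <;> simp [hy]

lemma damp_iterate_one_le_one (ha : a ≤ 1) (n : ℕ) (z : E) :
    (stepOp (damp D a) K)^[n] (fun _ => 1) z ≤ 1 := by
  induction n generalizing z with
  | zero => simp
  | succ n ih =>
    rw [Function.iterate_succ_apply']
    calc _ ≤ stepOp (damp D a) K (fun _ => 1) z := stepOp_mono (fun y => ih y) z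
      _ = damp D a z := by rw [stepOp_const, mul_one]
      _ ≤ 1 := by unfold damp; split_ifs <;> simp [ha]

/-- Mass lost between times `n` and `n + 1` is what is killed on `D` at time `n`: one step sends `1`
to `1 - e 1_D`, and linearity of the iterates does the rest. -/
lemma damp_iterate_balance (hD : MeasurableSet D) (hae : a + e = 1) (n : ℕ) (z : E) :
    (stepOp (damp D a) K)^[n + 1] (fun _ => 1) z +
        e * (stepOp (damp D a) K)^[n] (D.indicator 1) z =
      (stepOp (damp D a) K)^[n] (fun _ => 1) z := by
  have hw := measurable_damp (a := a) hD
  have h1 : stepOp (damp D a) K (fun _ => 1) + (fun y => e * D.indicator 1 y) = fun _ => 1 := by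
    ext y
    rw [Pi.add_apply, stepOp_const, damp]
    by_cases hy : y ∈ D <;> simp [hy, hae]
  have h2 := congrArg (fun h => (stepOp (damp D a) K)^[n] h z) h1
  simp only [stepOp_iterate_add hw (measurable_stepOp hw measurable_const), Pi.add_apply,
    stepOp_iterate_const_mul hw e (measurable_one.indicator hD)] at h2
  rwa [Function.iterate_succ_apply]

/-- Summation by parts for the visits to `D`. -/
lemma damp_sum_by_parts (hD : MeasurableSet D) (hae : a + e = 1) (s : ℕ → ℝ≥0∞) (m : ℕ) (z : E) :
    ∑ n ∈ Finset.range m, e * (stepOp (damp D a) K)^[n] (D.indicator 1) z *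
        (∑ k ∈ Finset.range (n + 1), s k) +
      (stepOp (damp D a) K)^[m] (fun _ => 1) z * ∑ k ∈ Finset.range m, s k =
    ∑ n ∈ Finset.range m, s n * (stepOp (damp D a) K)^[n] (fun _ => 1) z := by
  induction m with
  | zero => simp
  | succ m ih =>
    rw [Finset.sum_range_succ,
      Finset.sum_range_succ (fun n => s n * (stepOp (damp D a) K)^[n] (fun _ => 1) z), ← ih,
      add_assoc, ← add_mul, add_comm (e * _), damp_iterate_balance hD hae, Finset.sum_range_succ s]
    ring

/-- The mass balance telescopes: total killed mass plus surviving mass is `1`. -/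
lemma damp_sum_visits_le (hD : MeasurableSet D) (hae : a + e = 1) (m : ℕ) (z : E) :
    ∑ n ∈ Finset.range m, (stepOp (damp D a) K)^[n] (D.indicator 1) z ≤ e⁻¹ := by
  have het : e ≠ ∞ := fun h => by simp [h] at hae
  have key : e * (∑ n ∈ Finset.range m, (stepOp (damp D a) K)^[n] (D.indicator 1) z) +
      (stepOp (damp D a) K)^[m] (fun _ => 1) z = 1 := by
    induction m with
    | zero => simp
    | succ m ih =>
      rw [Finset.sum_range_succ, mul_add, add_assoc,
        add_comm (e * (stepOp (damp D a) K)^[m] (D.indicator 1) z), damp_iterate_balance hD hae, ih]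
  rw [ENNReal.le_inv_iff_mul_le, mul_comm]
  exact le_self_add.trans key.le

/-- The damped potential of a function of the state. -/
lemma sum_damp_iterate_le_hitSum_add_returnSup (hD : MeasurableSet D) (hae : a + e = 1)
    {g : E → ℝ≥0∞} (hg : Measurable g) (m : ℕ) (z : E) :
    ∑ n ∈ Finset.range m, (stepOp (damp D a) K)^[n] g z ≤
      hitSum K D (fun _ => g) z + a * e⁻¹ * returnSup K D (fun _ => g) := by
  refine (sum_damp_iterate_le hD (fun _ => hg) m z).trans ?_
  gcongr
  calc _ ≤ ∑ n ∈ Finset.range m, (stepOp (damp D a) K)^[n]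
        (fun y => a * returnSup K D (fun _ => g) * D.indicator 1 y) z := by
        refine Finset.sum_le_sum fun n _ => stepOp_iterate_mono (fun y => ?_) n z
        by_cases hy : y ∈ D
        · simp only [hy, Set.indicator_of_mem, Pi.one_apply, mul_one]
          gcongr
          exact le_iSup₂ (f := fun z _ => returnSum K D (fun _ => g) z) y hy
        · simp [hy]
    _ = a * returnSup K D (fun _ => g) *
          ∑ n ∈ Finset.range m, (stepOp (damp D a) K)^[n] (D.indicator 1) z := by
        simp only [stepOp_iterate_const_mul (measurable_damp hD) _ (measurable_one.indicator hD),
          Finset.mul_sum]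
    _ ≤ a * returnSup K D (fun _ => g) * e⁻¹ := by
        gcongr; exact damp_sum_visits_le hD hae m z
    _ = _ := by ring

end Damp

/-! ### Subgeometric rates and absorption of the error term. -/

section Rate

lemma IsSubgeometric.one_le {r : ℕ → ℝ} (hr : IsSubgeometric r) {n : ℕ} (hn : 1 ≤ n) :
    1 ≤ r n := by
  have h0 : 0 ≤ Real.log (r n) / n :=
    le_of_tendsto hr.tendsto (eventually_atTop.2 ⟨n, fun k hk => hr.anti n k hn hk⟩)
  have hn' : (0 : ℝ) < n := by exact_mod_cast hn
  have h1 : 0 ≤ Real.log (r n) := by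
    by_contra! h
    exact absurd h0 (not_le.2 (div_neg_of_neg_of_pos h hn'))
  exact (Real.log_nonneg_iff (hr.pos n)).1 h1

/-- Since `log r(n) / n` is non-increasing, `log r` is subadditive on positive integers. Index `0`
is excluded, as `r 0` may be less than `1`. -/
lemma IsSubgeometric.apply_add_le {r : ℕ → ℝ} (hr : IsSubgeometric r) {m n : ℕ} (hm : 1 ≤ m)
    (hn : 1 ≤ n) : r (m + n) ≤ r m * r n := by
  have hm' : (0 : ℝ) < m := by exact_mod_cast hm
  have hn' : (0 : ℝ) < n := by exact_mod_cast hn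
  have h1 := hr.anti m (m + n) hm (by omega)
  have h2 := hr.anti n (m + n) hn (by omega)
  rw [le_div_iff₀ hm'] at h1
  rw [le_div_iff₀ hn'] at h2
  push_cast at h1 h2
  have h3 : Real.log (r (m + n)) / (m + n) * m + Real.log (r (m + n)) / (m + n) * n =
      Real.log (r (m + n)) := by
    field_simp
  rw [← Real.log_le_log_iff (hr.pos _) (mul_pos (hr.pos _) (hr.pos _)),
    Real.log_mul (hr.pos _).ne' (hr.pos _).ne']
  linarith

variable {E : Type*} [MeasurableSpace E] {K : Kernel E E} [IsMarkovKernel K] {D : Set E}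

lemma returnSum_shift_le (hD : MeasurableSet D) {s : ℕ → ℝ≥0∞} {n : ℕ}
    (hs : ∀ k, s (n + (k + 1)) ≤ s n * s (k + 1)) (z : E) :
    returnSum K D (fun k _ => s (n + k)) z ≤ s n * returnSum K D (fun k _ => s k) z := by
  have hw : Measurable (Dᶜ.indicator (1 : E → ℝ≥0∞)) := measurable_one.indicator hD.compl
  rw [returnSum_eq_tsum K hD fun k => measurable_const,
    returnSum_eq_tsum K hD fun k => measurable_const, ← ENNReal.tsum_mul_left]
  refine ENNReal.tsum_le_tsum fun k => ?_
  rw [← lintegral_const_mul _ (measurable_stepOp_iterate hw measurable_const k)]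
  refine lintegral_mono fun y => ?_
  have := congrFun (stepOp_iterate_const_mul (K := K) hw (s n)
    (measurable_const (a := s (k + 1))) k) y
  exact (stepOp_iterate_mono (fun _ => hs k) k y).trans this.le

/-- The damped potential of a subgeometric rate. -/
lemma sum_damp_rate_le (hD : MeasurableSet D) {ε δ : ℝ} (hε0 : 0 < ε) (hε1 : ε ≤ 1) (hδ : 0 < δ)
    {r : ℕ → ℝ} (hr : IsSubgeometric r) (m : ℕ) (z : E) :
    ∑ n ∈ Finset.range m, ENNReal.ofReal (r n) *
        (stepOp (damp D (ENNReal.ofReal (1 - ε))) K)^[n] (fun _ => 1) z ≤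
      ENNReal.ofReal (1 + δ) * hitSum K D (fun k _ => ENNReal.ofReal (r k)) z +
        ENNReal.ofReal (1 - ε) * (ENNReal.ofReal ε)⁻¹ *
          constM (returnSup K D fun k _ => ENNReal.ofReal (r k)) r ε δ := by
  set a := ENNReal.ofReal (1 - ε) with ha
  set e := ENNReal.ofReal ε with he
  set s : ℕ → ℝ≥0∞ := fun k => ENNReal.ofReal (r k) with hs
  set Rs := returnSup K D fun k _ => s k with hRs
  set H := hitSum K D (fun k _ => s k) z with hH
  set u : ℕ → ℝ≥0∞ := fun n => (stepOp (damp D a) K)^[n] (fun _ => 1) z with hu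
  set d : ℕ → ℝ≥0∞ := fun n => (stepOp (damp D a) K)^[n] (D.indicator 1) z with hd
  have hw := measurable_damp (a := a) hD
  have hae : a + e = 1 := by
    rw [ha, he, ← ENNReal.ofReal_add (by linarith) hε0.le]; simp
  have hr0 : ∀ n, 0 ≤ r n := fun n => (hr.pos n).le
  set c0 := ENNReal.ofReal ((1 - ε) * δ / (1 + δ)) with hc0
  set M' : ℝ≥0∞ := ⨆ n : ℕ, (Rs * s n -
      ENNReal.ofReal (ε * (1 - ε) * δ * (∑ k ∈ Finset.range (n + 1), r k) / (1 + δ))) with hM'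
  have hRM : ∀ n, Rs * s n ≤ M' + e * c0 * ∑ k ∈ Finset.range (n + 1), s k := by
    intro n
    have h1 : ENNReal.ofReal (ε * (1 - ε) * δ * (∑ k ∈ Finset.range (n + 1), r k) / (1 + δ)) =
        e * c0 * ∑ k ∈ Finset.range (n + 1), s k := by
      rw [he, hc0, hs, ← ENNReal.ofReal_mul hε0.le,
        ← ENNReal.ofReal_sum_of_nonneg fun k _ => hr0 k, ← ENNReal.ofReal_mul]
      · congr 1; ring
      · have : 0 ≤ 1 - ε := by linarith
        positivity
    rw [← h1, ← tsub_le_iff_right]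
    exact le_iSup (fun n : ℕ => Rs * s n -
      ENNReal.ofReal (ε * (1 - ε) * δ * (∑ k ∈ Finset.range (n + 1), r k) / (1 + δ))) n
  have hret : ∀ n, ∀ y ∈ D, returnSum K D (fun k _ => s (n + k)) y ≤
      M' + e * c0 * (∑ k ∈ Finset.range (n + 1), s k) + if n = 0 then e * c0 * s 1 else 0 := by
    intro n y hy
    have hy' : returnSum K D (fun k _ => s k) y ≤ Rs :=
      le_iSup₂ (f := fun z _ => returnSum K D (fun k _ => s k) z) y hy
    -- Submultiplicativity is not available at `n = 0`. There `1 ≤ r 1` lets the bound at index `1`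
    -- serve instead, at the cost of the extra term `e * c0 * s 1`.
    rcases Nat.eq_zero_or_pos n with rfl | hn
    · simp only [zero_add, if_true]
      calc _ ≤ Rs * 1 := by simpa using hy'
        _ ≤ Rs * s 1 := by gcongr; simpa [hs] using hr.one_le le_rfl
        _ ≤ _ := hRM 1
        _ = _ := by rw [Finset.sum_range_succ, mul_add, add_assoc]
    · simp only [hn.ne', if_false, add_zero]
      refine (returnSum_shift_le hD (fun k => ?_) y).trans ?_
      · simp only [hs]
        rw [← ENNReal.ofReal_mul (hr0 n)]
        exact ENNReal.ofReal_le_ofReal (hr.apply_add_le hn (by omega))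
      · exact le_trans (by rw [mul_comm]; gcongr) (hRM n)
  -- At least two terms are kept so that `s 1 * u 1` is part of the sum; it will pay for the extra
  -- term at `n = 0`.
  suffices key : ∀ m, 2 ≤ m → ∑ n ∈ Finset.range m, s n * u n ≤
      ENNReal.ofReal (1 + δ) * H + a * e⁻¹ * constM Rs r ε δ by
    refine le_trans (Finset.sum_le_sum_of_subset (Finset.range_mono (?_ : m ≤ m + 2)))
      (key (m + 2) (by omega))
    omega
  intro m hm
  set S := ∑ n ∈ Finset.range m, s n * u n with hS
  -- Finiteness of the partial sum is what permits cancelling a multiple of `S` at the end.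
  have hSfin : S ≠ ∞ := by
    refine (ENNReal.sum_lt_top.2 fun n _ => ENNReal.mul_lt_top ENNReal.ofReal_lt_top ?_).ne
    exact (damp_iterate_one_le_one (hae ▸ le_self_add) n z).trans_lt ENNReal.one_lt_top
  have hdec : S ≤ H + ∑ n ∈ Finset.range m,
      a * (M' + e * c0 * (∑ k ∈ Finset.range (n + 1), s k) +
        if n = 0 then e * c0 * s 1 else 0) * d n := by
    have h1 := sum_damp_iterate_le (K := K) (a := a) hD (g := fun k _ => s k)
      (fun k => measurable_const) m z
    have h2 : ∀ n, (stepOp (damp D a) K)^[n] (fun _ => s n) z = s n * u n := fun n => by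
      simpa using congrFun (stepOp_iterate_const_mul (K := K) hw (s n)
        (measurable_const (a := (1 : ℝ≥0∞))) n) z
    simp only [h2] at h1
    refine h1.trans ?_
    gcongr with n hn
    rw [hd, ← congrFun (stepOp_iterate_const_mul (K := K) hw _
        (measurable_one.indicator hD) n) z]
    refine stepOp_iterate_mono (fun y => ?_) n z
    by_cases hy : y ∈ D
    · simp only [hy, Set.indicator_of_mem, Pi.one_apply, mul_one]
      gcongr
      exact hret n y hy
    · simp [hy]
  have hvis : ∑ n ∈ Finset.range m, d n ≤ e⁻¹ := damp_sum_visits_le hD hae m z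
  have habel : ∑ n ∈ Finset.range m, e * d n * (∑ k ∈ Finset.range (n + 1), s k) ≤ S :=
    le_self_add.trans (damp_sum_by_parts hD hae s m z).le
  have hfirst : a * d 0 * s 1 ≤ S := by
    have h1 : a * d 0 ≤ u 1 := by
      simp only [hd, hu, Function.iterate_zero, id, Function.iterate_one, stepOp_const, mul_one]
      by_cases hz : z ∈ D <;> simp [damp, hz]
    calc a * d 0 * s 1 ≤ s 1 * u 1 := by rw [mul_comm]; gcongr
      _ ≤ S := Finset.single_le_sum (f := fun n => s n * u n) (fun _ _ => zero_le)
          (Finset.mem_range.2 hm)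
  have hS1 : S ≤ H + a * e⁻¹ * M' + c0 * S := by
    refine hdec.trans ?_
    have h1 : ∑ n ∈ Finset.range m,
        a * (M' + e * c0 * (∑ k ∈ Finset.range (n + 1), s k) +
          if n = 0 then e * c0 * s 1 else 0) * d n =
        a * M' * ∑ n ∈ Finset.range m, d n +
          a * c0 * ∑ n ∈ Finset.range m, e * d n * (∑ k ∈ Finset.range (n + 1), s k) +
          e * c0 * (a * d 0 * s 1) := by
      have h2 : ∑ n ∈ Finset.range m, (if n = 0 then a * (e * c0 * s 1) * d n else 0) =
          e * c0 * (a * d 0 * s 1) := by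
        rw [Finset.sum_ite_eq' (Finset.range m) 0, if_pos (Finset.mem_range.2 (by omega))]
        ring
      rw [← h2, Finset.mul_sum, Finset.mul_sum, ← Finset.sum_add_distrib,
        ← Finset.sum_add_distrib]
      refine Finset.sum_congr rfl fun n _ => ?_
      split_ifs <;> ring
    rw [h1, add_assoc H (a * e⁻¹ * M')]
    refine add_le_add le_rfl ?_
    calc _ ≤ a * M' * e⁻¹ + a * c0 * S + e * c0 * S :=
          add_le_add (add_le_add (mul_le_mul' le_rfl hvis) (mul_le_mul' le_rfl habel))
            (mul_le_mul' le_rfl hfirst)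
      -- The visits cost `a * c0 * S` and the correction at `n = 0` costs `e * c0 * S`, together
      -- exactly `c0 * S`.
      _ = a * e⁻¹ * M' + (a + e) * (c0 * S) := by ring
      _ = _ := by rw [hae, one_mul]
  -- The product is `(1 - ε) δ`, so after multiplication by `1 + δ` the error fits in the `δ S` part
  -- of the left side.
  have hc1 : ENNReal.ofReal (1 + δ) * c0 ≤ ENNReal.ofReal δ := by
    rw [hc0, ← ENNReal.ofReal_mul (by linarith)]
    refine ENNReal.ofReal_le_ofReal ?_
    rw [mul_div_cancel₀ _ (by linarith)]
    nlinarith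
  have hfin : ENNReal.ofReal δ * S ≠ ∞ := ENNReal.mul_ne_top ENNReal.ofReal_ne_top hSfin
  refine (ENNReal.add_le_add_iff_right hfin).1 ?_
  calc S + ENNReal.ofReal δ * S = ENNReal.ofReal (1 + δ) * S := by
        rw [ENNReal.ofReal_add zero_le_one hδ.le, ENNReal.ofReal_one, add_mul, one_mul]
    _ ≤ ENNReal.ofReal (1 + δ) * (H + a * e⁻¹ * M' + c0 * S) := by gcongr
    _ = ENNReal.ofReal (1 + δ) * H + a * e⁻¹ * (ENNReal.ofReal (1 + δ) * M') +
          ENNReal.ofReal (1 + δ) * c0 * S := by ring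
    _ ≤ ENNReal.ofReal (1 + δ) * H + a * e⁻¹ * constM Rs r ε δ + ENNReal.ofReal δ * S := by
        gcongr
        rfl

end Rate

/-! ### From the coupling kernel to the `f`-norm. -/

section Coupling

variable {X : Type*} [MeasurableSpace X] {P : Kernel X X} [IsMarkovKernel P] {C : Set X} {ε : ℝ}
  {ν : Measure X} [IsProbabilityMeasure ν]

/-- The splitting of `P(x, ·)` on the small set: a measure with the values of the residual kernel
completes `ε ν`. -/
lemma eq_smul_residual_add (hε0 : 0 < ε) (hε1 : ε ≤ 1) (hsmall : IsSmall P C ε ν) {x : X}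
    (hx : x ∈ C) {κ : Measure X} (hκ : ∀ A, MeasurableSet A → κ A = residual P ε ν x A) :
    P x = ENNReal.ofReal (1 - ε) • κ + ENNReal.ofReal ε • ν := by
  rcases hε1.lt_or_eq with h | rfl
  · ext A hA
    have ha0 : ENNReal.ofReal (1 - ε) ≠ 0 := by simpa using h
    simp only [Measure.add_apply, Measure.smul_apply, smul_eq_mul, hκ A hA, residual, h, if_true]
    rw [← mul_assoc, ENNReal.mul_inv_cancel ha0 ENNReal.ofReal_ne_top, one_mul,
      tsub_add_cancel_of_le (hsmall x hx A hA)]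
  -- For `ε = 1` the minorization compares two probability measures, which must then be equal.
  · have hle : ν ≤ P x := Measure.le_iff.2 fun A hA => by simpa using hsmall x hx A hA
    simpa using (Measure.eq_of_le_of_measure_univ_eq hle (by simp)).symm

lemma integrable_of_abs_le {μ : Measure X} [IsFiniteMeasure μ] {φ : X → ℝ} (hφ : Measurable φ)
    {B : ℝ} (hB : ∀ y, |φ y| ≤ B) : Integrable φ μ :=
  Integrable.of_bound hφ.aestronglyMeasurable B (Eventually.of_forall hB)

variable {K : Kernel (X × X) (X × X)} [IsMarkovKernel K]

/-- On `C × C` the common `ε ν` parts cancel and leave the factor `1 - ε` times a difference of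
marginals of `K`; elsewhere those marginals are the laws themselves. -/
lemma ofReal_abs_integral_sub_le (hε0 : 0 < ε) (hε1 : ε ≤ 1) (hsmall : IsSmall P C ε ν)
    (hK : IsCouplingKernel K P C ε ν) {φ : X → ℝ} (hφ : Measurable φ) {B : ℝ}
    (hB : ∀ y, |φ y| ≤ B) (x x' : X) :
    ENNReal.ofReal |∫ y, φ y ∂(P x) - ∫ y, φ y ∂(P x')| ≤
      stepOp (damp (C ×ˢ C) (ENNReal.ofReal (1 - ε))) K
        (fun z => ENNReal.ofReal |φ z.1 - φ z.2|) (x, x') := by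
  have hfst : ∀ A, MeasurableSet A →
      (K (x, x')).map Prod.fst A = K (x, x') (A ×ˢ Set.univ) := fun A hA => by
    rw [Measure.map_apply measurable_fst hA, Set.prod_univ]
  have hsnd : ∀ A, MeasurableSet A →
      (K (x, x')).map Prod.snd A = K (x, x') (Set.univ ×ˢ A) := fun A hA => by
    rw [Measure.map_apply measurable_snd hA, Set.univ_prod]
  have hmap1 : ∫ y, φ y ∂((K (x, x')).map Prod.fst) = ∫ z, φ z.1 ∂(K (x, x')) :=
    integral_map (by fun_prop) hφ.aestronglyMeasurable
  have hmap2 : ∫ y, φ y ∂((K (x, x')).map Prod.snd) = ∫ z, φ z.2 ∂(K (x, x')) :=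
    integral_map (by fun_prop) hφ.aestronglyMeasurable
  have hi1 : Integrable (fun z : X × X => φ z.1) (K (x, x')) :=
    integrable_of_abs_le (hφ.comp measurable_fst) fun z => hB z.1
  have hi2 : Integrable (fun z : X × X => φ z.2) (K (x, x')) :=
    integrable_of_abs_le (hφ.comp measurable_snd) fun z => hB z.2
  have hbound : ENNReal.ofReal |∫ z, φ z.1 ∂(K (x, x')) - ∫ z, φ z.2 ∂(K (x, x'))| ≤
      ∫⁻ z, ENNReal.ofReal |φ z.1 - φ z.2| ∂(K (x, x')) := by
    rw [← integral_sub hi1 hi2]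
    have := enorm_integral_le_lintegral_enorm (μ := K (x, x')) fun z : X × X => φ z.1 - φ z.2
    simpa only [Real.enorm_eq_ofReal_abs] using this
  unfold stepOp damp
  by_cases hz : (x, x') ∈ C ×ˢ C
  · have h1 : P x = ENNReal.ofReal (1 - ε) • (K (x, x')).map Prod.fst + ENNReal.ofReal ε • ν :=
      eq_smul_residual_add hε0 hε1 hsmall hz.1 fun A hA => by
        rw [hfst A hA, hK.fst x x' A hA, if_pos hz]
    have h2 : P x' = ENNReal.ofReal (1 - ε) • (K (x, x')).map Prod.snd + ENNReal.ofReal ε • ν :=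
      eq_smul_residual_add hε0 hε1 hsmall hz.2 fun A hA => by
        rw [hsnd A hA, hK.snd x x' A hA, if_pos hz]
    have hint : ∀ κ : Measure X, IsFiniteMeasure κ →
        ∫ y, φ y ∂(ENNReal.ofReal (1 - ε) • κ + ENNReal.ofReal ε • ν) =
          (1 - ε) * ∫ y, φ y ∂κ + ε * ∫ y, φ y ∂ν := fun κ hκ => by
      rw [integral_add_measure ((integrable_of_abs_le hφ hB).smul_measure ENNReal.ofReal_ne_top)
        ((integrable_of_abs_le hφ hB).smul_measure ENNReal.ofReal_ne_top), integral_smul_measure,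
        integral_smul_measure, ENNReal.toReal_ofReal (by linarith),
        ENNReal.toReal_ofReal hε0.le, smul_eq_mul, smul_eq_mul]
    rw [if_pos hz, h1, h2, hint _ inferInstance, hint _ inferInstance, hmap1, hmap2,
      add_sub_add_right_eq_sub, ← mul_sub, abs_mul, abs_of_nonneg (by linarith : 0 ≤ 1 - ε),
      ENNReal.ofReal_mul (by linarith)]
    gcongr
  · have h1 : P x = (K (x, x')).map Prod.fst := Measure.ext fun A hA => by
      rw [hfst A hA, hK.fst x x' A hA, if_neg hz]
    have h2 : P x' = (K (x, x')).map Prod.snd := Measure.ext fun A hA => by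
      rw [hsnd A hA, hK.snd x x' A hA, if_neg hz]
    rw [if_neg hz, one_mul, h1, h2, hmap1, hmap2]
    exact hbound

instance isMarkovKernel_pow (n : ℕ) : IsMarkovKernel (P ^ n : Kernel X X) := by
  induction n with
  | zero => rw [pow_zero]; exact inferInstanceAs (IsMarkovKernel Kernel.id)
  | succ n ih => rw [pow_succ]; exact inferInstanceAs (IsMarkovKernel ((P ^ n) ∘ₖ P))

lemma ofReal_abs_integral_pow_sub_le (hε0 : 0 < ε) (hε1 : ε ≤ 1) (hsmall : IsSmall P C ε ν)
    (hK : IsCouplingKernel K P C ε ν) {g : X → ℝ} (hg : Measurable g) {B : ℝ}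
    (hB : ∀ y, |g y| ≤ B) (n : ℕ) (x x' : X) :
    ENNReal.ofReal |∫ y, g y ∂((P ^ n : Kernel X X) x) - ∫ y, g y ∂((P ^ n : Kernel X X) x')| ≤
      (stepOp (damp (C ×ˢ C) (ENNReal.ofReal (1 - ε))) K)^[n]
        (fun z => ENNReal.ofReal |g z.1 - g z.2|) (x, x') := by
  induction n generalizing x x' with
  | zero =>
    have h : ∀ v : X, ∫ y, g y ∂((P ^ 0 : Kernel X X) v) = g v := fun v => by
      rw [pow_zero, show (1 : Kernel X X) = Kernel.id from rfl, Kernel.id_apply]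
      exact integral_dirac' _ _ hg.stronglyMeasurable
    rw [h, h, Function.iterate_zero, id]
  | succ n ih =>
    have hstep : ∀ v : X, ∫ y, g y ∂((P ^ (n + 1) : Kernel X X) v) =
        ∫ u, ∫ y, g y ∂((P ^ n : Kernel X X) u) ∂(P v) := fun v => by
      rw [pow_succ, show (P ^ n * P : Kernel X X) = (P ^ n) ∘ₖ P from rfl]
      exact Kernel.integral_comp (integrable_of_abs_le hg hB)
    have hφ : Measurable fun u => ∫ y, g y ∂((P ^ n : Kernel X X) u) :=
      (hg.stronglyMeasurable.integral_kernel (κ := P ^ n)).measurable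
    have hφB : ∀ u, |∫ y, g y ∂((P ^ n : Kernel X X) u)| ≤ B := fun u => by
      simpa using norm_integral_le_of_norm_le_const (μ := (P ^ n : Kernel X X) u)
        (f := g) (C := B) (Eventually.of_forall hB)
    rw [hstep, hstep, Function.iterate_succ_apply']
    exact (ofReal_abs_integral_sub_le hε0 hε1 hsmall hK hφ hφB x x').trans
      (stepOp_mono (fun z => ih z.1 z.2) (x, x'))

lemma ofReal_abs_integral_pow_sub_le_of_integrable (hε0 : 0 < ε) (hε1 : ε ≤ 1)
    (hsmall : IsSmall P C ε ν) (hK : IsCouplingKernel K P C ε ν) {g : X → ℝ} (hg : Measurable g)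
    (n : ℕ) (x x' : X) (hx : Integrable g ((P ^ n : Kernel X X) x))
    (hx' : Integrable g ((P ^ n : Kernel X X) x')) :
    ENNReal.ofReal |∫ y, g y ∂((P ^ n : Kernel X X) x) - ∫ y, g y ∂((P ^ n : Kernel X X) x')| ≤
      (stepOp (damp (C ×ˢ C) (ENNReal.ofReal (1 - ε))) K)^[n]
        (fun z => ENNReal.ofReal (|g z.1| + |g z.2|)) (x, x') := by
  -- The iteration over `n` needs bounded functions, so `g` is truncated at level `N`; dominated
  -- convergence recovers the integrals.
  set t : ℕ → X → ℝ := fun N y => max (-N) (min N (g y)) with ht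
  have htm : ∀ N, Measurable (t N) := fun N => measurable_const.max (measurable_const.min hg)
  have htN : ∀ (N : ℕ) y, |t N y| ≤ N := fun N y =>
    abs_le.2 ⟨le_max_left _ _, max_le (by have := N.cast_nonneg (α := ℝ); linarith)
      (min_le_left _ _)⟩
  have htg : ∀ (N : ℕ) y, |t N y| ≤ |g y| := fun N y => by
    have hN := N.cast_nonneg (α := ℝ)
    refine abs_le.2 ⟨?_, max_le (by linarith [abs_nonneg (g y)])
      ((min_le_right _ _).trans (le_abs_self _))⟩
    exact (le_min (by linarith [abs_nonneg (g y)]) (neg_abs_le _)).trans (le_max_right _ _)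
  have htlim : ∀ y, Tendsto (fun N => t N y) atTop (𝓝 (g y)) := fun y => by
    obtain ⟨N₀, hN₀⟩ := exists_nat_ge |g y|
    refine tendsto_const_nhds.congr' (eventually_atTop.2 ⟨N₀, fun N hN => ?_⟩)
    have h : |g y| ≤ N := hN₀.trans (by exact_mod_cast hN)
    simp only [ht]
    rw [min_eq_right (abs_le.1 h).2, max_eq_right (abs_le.1 h).1]
  have hlim : ∀ μ : Measure X, Integrable g μ →
      Tendsto (fun N => ∫ y, t N y ∂μ) atTop (𝓝 (∫ y, g y ∂μ)) := fun μ hμ =>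
    tendsto_integral_of_dominated_convergence (fun y => |g y|)
      (fun N => (htm N).aestronglyMeasurable) hμ.abs
      (fun N => Eventually.of_forall fun y => htg N y) (Eventually.of_forall htlim)
  refine le_of_tendsto (ENNReal.tendsto_ofReal ((hlim _ hx).sub (hlim _ hx')).abs)
    (Eventually.of_forall fun N => ?_)
  refine (ofReal_abs_integral_pow_sub_le hε0 hε1 hsmall hK (htm N) (htN N) n x x').trans
    (stepOp_iterate_mono (fun z => ENNReal.ofReal_le_ofReal ?_) n _)
  exact (abs_sub _ _).trans (add_le_add (htg N _) (htg N _))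

/-- Neither `f` nor `G` need be measurable: the constant is moved through the iterates for the
measurable `g`, and only monotonicity is used to pass to `f` and `G`. -/
lemma mul_fNorm_pow_le (hC : MeasurableSet C) (hε0 : 0 < ε) (hε1 : ε ≤ 1)
    (hsmall : IsSmall P C ε ν) (hK : IsCouplingKernel K P C ε ν) {f : X → ℝ} {c : ℝ≥0∞}
    {G : X × X → ℝ≥0∞} (hG : ∀ y y', c * ENNReal.ofReal (f y + f y') ≤ G (y, y')) (n : ℕ)
    (x x' : X) :
    c * fNorm f ((P ^ n : Kernel X X) x) ((P ^ n : Kernel X X) x') ≤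
      (stepOp (damp (C ×ˢ C) (ENNReal.ofReal (1 - ε))) K)^[n] G (x, x') := by
  simp only [fNorm, ENNReal.mul_iSup]
  refine iSup_le fun g => iSup_le fun hg => iSup_le fun hgf => iSup_le fun hx => iSup_le fun hx' =>
    ?_
  have hm : Measurable fun z : X × X => ENNReal.ofReal (|g z.1| + |g z.2|) := by fun_prop
  calc _ ≤ c * (stepOp (damp (C ×ˢ C) (ENNReal.ofReal (1 - ε))) K)^[n]
        (fun z => ENNReal.ofReal (|g z.1| + |g z.2|)) (x, x') := by
        gcongr
        exact ofReal_abs_integral_pow_sub_le_of_integrable hε0 hε1 hsmall hK hg n x x' hx hx'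
    _ = (stepOp (damp (C ×ˢ C) (ENNReal.ofReal (1 - ε))) K)^[n]
        (fun z => c * ENNReal.ofReal (|g z.1| + |g z.2|)) (x, x') :=
        (congrFun (stepOp_iterate_const_mul (measurable_damp (hC.prod hC)) c hm n) (x, x')).symm
    _ ≤ _ := stepOp_iterate_mono (fun z : X × X => le_trans
        (mul_le_mul' le_rfl (ENNReal.ofReal_le_ofReal (add_le_add (hgf _) (hgf _))))
        (hG z.1 z.2)) n _

end Coupling

end

end Subgeom

/-! ### Assembly of the two potentials. -/

theorem corollary1 {X : Type*} [MeasurableSpace X]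
    (P : Kernel X X) [IsMarkovKernel P]
    (C : Set X) (hC : MeasurableSet C)
    (ε : ℝ) (hε0 : 0 < ε) (hε1 : ε ≤ 1)
    (ν : Measure X) [IsProbabilityMeasure ν]
    (hsmall : IsSmall P C ε ν)
    (K : Kernel (X × X) (X × X)) [IsMarkovKernel K]
    (hK : IsCouplingKernel K P C ε ν)
    (r : ℕ → ℝ) (hr : IsSubgeometric r)
    (W : X × X → ℝ) (hWm : Measurable W) (hW : ∀ z, 1 ≤ W z)
    (ρ : ℝ) (hρ0 : 0 ≤ ρ) (hρ1 : ρ ≤ 1)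
    (α β : ℝ → ℝ) (hα : ∀ u, 0 < u → 0 ≤ α u) (hβ : ∀ v, 0 < v → 0 ≤ β v)
    (hαβ : ∀ u v, 0 < u → 0 < v → α u * β v ≤ ρ * u + (1 - ρ) * v)
    (f : X → ℝ) (hf0 : ∀ y, 0 ≤ f y) (hf : ∀ y y', f y + f y' ≤ β (W (y, y')))
    (δ : ℝ) (hδ : 0 < δ) (x x' : X) :
    ∑' n : ℕ, ENNReal.ofReal (α (r (n + 1))) *
        fNorm f ((P ^ (n + 1) : Kernel X X) x) ((P ^ (n + 1) : Kernel X X) x') ≤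
      ENNReal.ofReal (ρ * (1 + δ)) *
          hitSum K (C ×ˢ C) (fun k _ => ENNReal.ofReal (r k)) (x, x')
      + ENNReal.ofReal (1 - ρ) *
          hitSum K (C ×ˢ C) (fun _ z => ENNReal.ofReal (W z)) (x, x')
      + ENNReal.ofReal ((1 - ε) / ε) *
          (ENNReal.ofReal ρ *
              constM (returnSup K (C ×ˢ C) (fun k _ => ENNReal.ofReal (r k))) r ε δ
            + ENNReal.ofReal (1 - ρ) *
              returnSup K (C ×ˢ C) (fun _ z => ENNReal.ofReal (W z))) := by
  set a := ENNReal.ofReal (1 - ε) with ha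
  set e := ENNReal.ofReal ε with he
  have hD : MeasurableSet (C ×ˢ C) := hC.prod hC
  have hw := measurable_damp (a := a) hD
  have hae : a + e = 1 := by
    rw [ha, he, ← ENNReal.ofReal_add (by linarith) hε0.le]; simp
  have hr0 : ∀ n, 0 ≤ r n := fun n => (hr.pos n).le
  have hWm' : Measurable fun z => ENNReal.ofReal (W z) := hWm.ennreal_ofReal
  have hterm : ∀ n, ENNReal.ofReal (α (r n)) *
        fNorm f ((P ^ n : Kernel X X) x) ((P ^ n : Kernel X X) x') ≤
      ENNReal.ofReal ρ * (ENNReal.ofReal (r n) *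
          (stepOp (damp (C ×ˢ C) a) K)^[n] (fun _ => 1) (x, x')) +
        ENNReal.ofReal (1 - ρ) *
          (stepOp (damp (C ×ˢ C) a) K)^[n] (fun z => ENNReal.ofReal (W z)) (x, x') := by
    intro n
    refine (mul_fNorm_pow_le hC hε0 hε1 hsmall hK
      (G := (fun _ => ENNReal.ofReal ρ * ENNReal.ofReal (r n) * 1) +
        fun z => ENNReal.ofReal (1 - ρ) * ENNReal.ofReal (W z)) (fun y y' => ?_) n x x').trans
        (le_of_eq ?_)
    · have hWpos : 0 < W (y, y') := zero_lt_one.trans_le (hW _)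
      rw [← ENNReal.ofReal_mul (hα _ (hr.pos n)), Pi.add_apply, mul_one,
        ← ENNReal.ofReal_mul hρ0, ← ENNReal.ofReal_mul (by linarith),
        ← ENNReal.ofReal_add (mul_nonneg hρ0 (hr0 n)) (mul_nonneg (by linarith) hWpos.le)]
      exact ENNReal.ofReal_le_ofReal ((mul_le_mul_of_nonneg_left (hf y y')
        (hα _ (hr.pos n))).trans (hαβ _ _ (hr.pos n) hWpos))
    · rw [stepOp_iterate_add hw measurable_const, Pi.add_apply,
        stepOp_iterate_const_mul hw _ measurable_const, stepOp_iterate_const_mul hw _ hWm']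
      simp only [mul_assoc]
  have hrate := sum_damp_rate_le (K := K) hD hε0 hε1 hδ hr
  have hstate := sum_damp_iterate_le_hitSum_add_returnSup (K := K) hD hae hWm'
  refine ENNReal.tsum_le_of_sum_range_le fun m => ?_
  -- The term `n = 0` is added for free, since the potential bounds start at time `0`.
  calc _ ≤ ∑ n ∈ Finset.range (m + 1), ENNReal.ofReal (α (r n)) *
        fNorm f ((P ^ n : Kernel X X) x) ((P ^ n : Kernel X X) x') := by
        rw [Finset.sum_range_succ']; exact le_self_add
    _ ≤ _ := Finset.sum_le_sum fun n _ => hterm n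
    _ = ENNReal.ofReal ρ * (∑ n ∈ Finset.range (m + 1), ENNReal.ofReal (r n) *
          (stepOp (damp (C ×ˢ C) a) K)^[n] (fun _ => 1) (x, x')) +
        ENNReal.ofReal (1 - ρ) * ∑ n ∈ Finset.range (m + 1),
          (stepOp (damp (C ×ˢ C) a) K)^[n] (fun z => ENNReal.ofReal (W z)) (x, x') := by
        rw [Finset.sum_add_distrib, Finset.mul_sum, Finset.mul_sum]
    _ ≤ _ := add_le_add (mul_le_mul' le_rfl (hrate (m + 1) (x, x')))
        (mul_le_mul' le_rfl (hstate (m + 1) (x, x')))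
    _ = _ := by
        rw [ENNReal.ofReal_mul hρ0, ENNReal.ofReal_div_of_pos hε0, div_eq_mul_inv]
        ring
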